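/- Let $n\ge 0$ and let $\mathcal P_n$ be the set of partitions $\lambda=(\lambda_1\ge\cdots\ge\lambda_n)\in\mathbb N^n$. Let $x_{(n)}=(x_1,\dots,x_n)$ and $y=(y_1,y_2,\dots)$ be variables. For $\lambda\in\mathcal P_n$ put $$s_\lambda(x_{(n)})=\sum_T\prod_{a\in T}x_a,\qquad s_\lambda(x_{(n)}\,|\,y)=\sum_T\prod_{a\in T}\bigl(x_a+y_{a+c(a)-r(a)}\bigr),$$ the sums being over all semistandard Young tableaux $T$ of shape $\lambda$ with entries in $\{1,\dots,n\}$, where $c(a)$ and $r(a)$ are the column and row numbers of the entry $a$. The families $(s_\mu(x_{(n)}))_{\mu\in\mathcal P_n}$ and $(s_\mu(x_{(n)}\,|\,y))_{\mu\in\mathcal P_n}$ are each linearly independent over $\mathbb Z[y]$, and there are unique finitely supported families of coefficients $c_{\lambda,n}^\mu(y),d_{\lambda,n}^\mu(y)\in\mathbb Z[y]$ with $$s_\lambda(x_{(n)}\,|\,y)=\sum_{\mu\in\mathcal P_n}c_{\lambda,n}^\mu(y)\,s_\mu(x_{(n)}),\qquad s_\lambda(x_{(n)})=\sum_{\mu\in\mathcal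 P_n}d_{\lambda,n}^\mu(y)\,s_\mu(x_{(n)}\,|\,y).$$ Let $e_r(z_{(p)})$ and $h_r(z_{(p)})$ be the elementary and complete symmetric polynomials of degree $r$ in $z_1,\dots,z_p$, which are $0$ for $r<0$, and let $-y=(-y_1,-y_2,\dots)$. For $\lambda\in\mathcal P_n$ and an integer $m\ge\lambda_1$ (any $m\ge 0$ if $n=0$), let $\lambda^c\in\mathcal P_m$ be the complementary partition, $\lambda^c_i=n-\lambda'_{m+1-i}$ for $1\le i\le m$, where $\lambda'_j=\#\{k:\lambda_k\ge j\}$. Then for all $\lambda,\mu\in\mathcal P_n$: (i) $c_{\lambda,n}^\mu(y)=\det\bigl(e_{\lambda_i-\mu_j-i+j}(y_{(\lambda_i+n-i)})\bigr)_{1\le i,j\le n}$; (ii) $d_{\lambda,n}^\mu(y)=\det\bigl(h_{\lambda_i-\mu_j-i+j}((-y)_{(\mu_j+n+1-j)})\bigr)_{1\le i,j\le n}$; (iii) $d_{\lambda,n}^\mu(y)=c_{\mu^c,m}^{\lambda^c}(-y)$ for every integer $m\ge 0$ with $m\ge\lambda_1$ and $m\ge\mu_1$, both complements being taken with respect to this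 $m$. -/

import Mathlib

open MvPolynomial

/-- `𝒫ₙ`: the partitions `(λ₁ ≥ ⋯ ≥ λₙ ≥ 0)`. The entry `lam.1 i` with `i = 0, …, n - 1` is
`λ_{i+1}`. -/
abbrev Parts (n : ℕ) : Type := {l : Fin n → ℕ // Antitone l}

/-- `ℤ[y]` with `y = (y₁, y₂, …)`; the variable `X k` is `y_{k+1}`. -/
abbrev ZY : Type := MvPolynomial ℕ ℤ

/-- `ℤ[x, y] = ℤ[y][x₁, …, xₙ]`; the variable `X i`, `i = 0, …, n - 1`, is `x_{i+1}`. -/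
abbrev ZXY (n : ℕ) : Type := MvPolynomial (Fin n) ZY

/-- The boxes of the Young diagram of `lam`: `⟨r, c⟩` is the box in row `r + 1`,
column `c + 1`. -/
abbrev Box {n : ℕ} (lam : Parts n) : Type := (r : Fin n) × Fin (lam.1 r)

/-- A filling of the diagram of `lam` is a Young (semistandard) tableau if its entries weakly
increase along rows and strictly increase down columns. -/
def IsTableau {n : ℕ} {lam : Parts n} (T : Box lam → Fin n) : Prop :=
  (∀ a b : Box lam, a.1 = b.1 → (a.2 : ℕ) ≤ b.2 → T a ≤ T b) ∧
    ∀ a b : Box lam, (a.2 : ℕ) = b.2 → a.1 < b.1 → T a < T b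

open Classical in
/-- All Young tableaux of shape `lam` with entries in `{1, …, n}`; an entry `a` is stored as
`a - 1 : Fin n`. -/
noncomputable def tableaux {n : ℕ} (lam : Parts n) : Finset (Box lam → Fin n) :=
  Finset.univ.filter IsTableau

/-- The Schur polynomial `s_λ(x_(n))`. -/
noncomputable def schurPoly {n : ℕ} (lam : Parts n) : ZXY n :=
  ∑ T ∈ tableaux lam, ∏ b : Box lam, X (T b)

/-- The factorial Schur polynomial `s_λ(x_(n) | y) = ∑_T ∏_a (x_a + y_{a + c(a) - r(a)})`.
Columns being strict, an entry is at least its row number, so the subtraction does not truncate;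
and `a + c - r` in indices from `1` is one more than `a + c - r` in indices from `0`. -/
noncomputable def factorialSchurPoly {n : ℕ} (lam : Parts n) : ZXY n :=
  ∑ T ∈ tableaux lam, ∏ b : Box lam,
    (X (T b) + C (X ((T b : ℕ) + (b.2 : ℕ) - (b.1 : ℕ))))

/-- The coefficients of an expansion `f = ∑ᵢ cᵢ bᵢ` (finitely many nonzero `cᵢ`). They are
determined when `b` is linearly independent and `f` lies in its span. -/
noncomputable def expansionCoeffs {ι R M : Type*} [CommRing R] [AddCommGroup M] [Module R M]
    (b : ι → M) (f : M) : ι →₀ R :=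
  Classical.epsilon fun c : ι →₀ R => f = Finsupp.linearCombination R b c

/-- `c_{λ,n}^μ(y)`, as a function of `μ`: the coefficients of `s_λ(x_(n) | y)` in the
Schur polynomials. -/
noncomputable def cCoeff {n : ℕ} (lam : Parts n) : Parts n →₀ ZY :=
  expansionCoeffs schurPoly (factorialSchurPoly lam)

/-- `d_{λ,n}^μ(y)`, as a function of `μ`: the coefficients of `s_λ(x_(n))` in the
factorial Schur polynomials. -/
noncomputable def dCoeff {n : ℕ} (lam : Parts n) : Parts n →₀ ZY :=
  expansionCoeffs factorialSchurPoly (schurPoly lam)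

/-- `e_r(z_(p)) = e_r(z₁, …, z_p)` for `r ∈ ℤ`, zero for `r < 0`; `z k` is `z_{k+1}`. -/
noncomputable def eInt {R : Type*} [CommRing R] (r : ℤ) (p : ℕ) (z : ℕ → R) : R :=
  if 0 ≤ r then aeval (fun i : Fin p => z i) (esymm (Fin p) ℤ r.toNat) else 0

/-- `h_r(z_(p)) = h_r(z₁, …, z_p)` for `r ∈ ℤ`, zero for `r < 0`; `z k` is `z_{k+1}`. -/
noncomputable def hInt {R : Type*} [CommRing R] (r : ℤ) (p : ℕ) (z : ℕ → R) : R :=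
  if 0 ≤ r then aeval (fun i : Fin p => z i) (hsymm (Fin p) ℤ r.toNat) else 0

/-- The substitution `f(y) ↦ f(-y)` on `ℤ[y]`. -/
noncomputable def negY : ZY →ₐ[ℤ] ZY := aeval fun k => -X k

/-- The conjugate partition: `conj lam j` is `λ'_{j+1}`, the length of column `j + 1`. -/
def conj {n : ℕ} (lam : Parts n) (j : ℕ) : ℕ :=
  (Finset.univ.filter fun i : Fin n => j < lam.1 i).card

/-- The complementary partition `λᶜ ∈ 𝒫ₘ`, `λᶜ_i = n - λ'_{m+1-i}` for `1 ≤ i ≤ m`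
(`Fin.rev` is `i ↦ m + 1 - i` in indices from `1`). -/
def complPart {n : ℕ} (m : ℕ) (lam : Parts n) : Parts m :=
  ⟨fun i => n - conj lam (Fin.rev i), fun i j hij => by
    refine Nat.sub_le_sub_left (Finset.card_le_card fun k hk => ?_) n
    simp only [Finset.mem_filter, Finset.mem_univ, true_and] at hk ⊢
    exact lt_of_le_of_lt (Fin.rev_le_rev.mpr hij) hk⟩

/-! The bialternant formula reduces everything to a change of basis in one variable. Multiplied by
the Vandermonde product, `s_λ(x | y)` becomes the alternant `det ((x_j | y)^{λ_i + n - i})`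
(`tableauSum_mul_vandermondeProd`), and `y = 0` gives the ordinary Schur polynomial. The proof is by
induction on the number of variables: removing the largest entry from a tableau leaves a tableau of
interlacing shape, and row operations on the alternant produce the same branching rule
(`alternant_succ`).

In one variable, `(z | y)^p = ∑ e_{p-q}(y_(p)) z^q` and `z^p = ∑ h_{p-q}((-y)_(q+1)) (z | y)^q`, so
the matrices `E = eMatrix` and `H = hMatrix` are mutually inverse. By Cauchy–Binet, with minors
indexed by partitions through their shifted parts, the alternants expand in one another with minors
of `E` and `H` as coefficients. Cancelling the Vandermonde product gives (i) and (ii), once both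
families are known to be independent.

For (iii), the shifted parts of `λ` and of `λᶜ` partition `{0, …, n + m - 1}`. Jacobi's identity
therefore equates a minor of `H`, up to sign, with the complementary minor of `E = H⁻¹`. The sign is
`(-1)^{|λ| + |μ|}`, and it is absorbed by passing from `y` to `-y`. -/

/-- The exponents `λ_i + n - i` (in indices from `1`) attached to a partition. -/
def shiftedPart {n : ℕ} (l : Fin n → ℕ) (i : Fin n) : ℕ := l i + (Fin.rev i : ℕ)

/-- The factorial power `(z | y)^p = (z + y₁) ⋯ (z + y_p)`. -/
def factorialPow {R : Type*} [CommRing R] (y : ℕ → R) (z : R) (p : ℕ) : R :=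
  ∏ k ∈ Finset.range p, (z + y k)

/-- The Vandermonde product `∏_{i < j} (x_i - x_j)`. -/
def vandermondeProd {R : Type*} [CommRing R] {n : ℕ} (x : Fin n → R) : R :=
  ∏ i, ∏ j, if i < j then x i - x j else 1

/-- The generalized alternant `det ((x_j | y)^{λ_i + n - i})`. -/
def alternant {R : Type*} [CommRing R] {n : ℕ} (y : ℕ → R) (x : Fin n → R)
    (l : Fin n → ℕ) : R :=
  (Matrix.of fun i j : Fin n => factorialPow y (x j) (shiftedPart l i)).det

/-! ### Branching rule for the generalized alternants -/

section Alternant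

variable {R : Type*} [CommRing R]

theorem factorialPow_succ (y : ℕ → R) (z : R) (p : ℕ) :
    factorialPow y z (p + 1) = factorialPow y z p * (z + y p) :=
  Finset.prod_range_succ _ _

theorem vandermondeProd_succ {n : ℕ} (x : Fin (n + 1) → R) :
    vandermondeProd x = vandermondeProd (fun i : Fin n => x i.castSucc) *
      ∏ j : Fin n, (x j.castSucc - x (Fin.last n)) := by
  unfold vandermondeProd
  rw [Fin.prod_univ_castSucc]
  simp only [Fin.prod_univ_castSucc (n := n), Fin.castSucc_lt_castSucc_iff, Fin.castSucc_lt_last,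
    if_true, lt_irrefl, if_false, Finset.prod_mul_distrib]
  simp [(Fin.castSucc_lt_last _).not_gt]

/-- Telescoping of `(x | y)^{b+d+1}` down to `(x | y)^{a+d}`. -/
theorem factorialPow_telescope (y : ℕ → R) (x z : R) (d : ℕ) {a b : ℕ} (hab : a ≤ b) :
    factorialPow y x (b + (d + 1)) =
      (x - z) * ∑ k ∈ Finset.Icc a b,
        (∏ c ∈ Finset.Ico k b, (z + y (d + 1 + c))) * factorialPow y x (k + d) +
      (∏ c ∈ Finset.Ico a (b + 1), (z + y (d + c))) * factorialPow y x (a + d) := by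
  -- Each step splits the newest factor as `x + y_p = (x - z) + (z + y_p)`.
  induction b, hab using Nat.le_induction with
  | base =>
    rw [← add_assoc, factorialPow_succ, add_comm a d, Finset.Icc_self, Finset.sum_singleton,
      Finset.Ico_self, Finset.prod_empty, Nat.Ico_succ_singleton, Finset.prod_singleton,
      add_comm a d]
    ring
  | succ b hab ih =>
    have h1 : b + 1 + (d + 1) = (b + (d + 1)) + 1 := by ring
    have h2 : ∀ k ∈ Finset.Icc a b,
        (∏ c ∈ Finset.Ico k (b + 1), (z + y (d + 1 + c))) * factorialPow y x (k + d) =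
        (z + y (d + 1 + b)) *
          ((∏ c ∈ Finset.Ico k b, (z + y (d + 1 + c))) * factorialPow y x (k + d)) := by
      intro k hk
      rw [Finset.prod_Ico_succ_top (Finset.mem_Icc.mp hk).2]
      ring
    rw [h1, factorialPow_succ, Finset.sum_Icc_succ_top (hab.trans b.le_succ),
      Finset.sum_congr rfl h2, ← Finset.mul_sum,
      Finset.prod_Ico_succ_top (hab.trans b.le_succ), Finset.Ico_self, Finset.prod_empty,
      show b + 1 + d = b + (d + 1) by ring, show d + (b + 1) = d + 1 + b by ring,
      show y (b + (d + 1)) = y (d + 1 + b) by rw [add_comm]]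
    generalize (∑ k ∈ Finset.Icc a b, _ : R) = S at *
    generalize (∏ c ∈ Finset.Ico a (b + 1), _ : R) = P at *
    linear_combination (z + y (d + 1 + b)) * ih

/-- Adding multiples of each following row to the rows does not change the determinant. -/
theorem det_eq_of_row_eq_add_mul_succ {n : ℕ} {A B : Matrix (Fin (n + 1)) (Fin (n + 1)) R}
    (c : Fin n → R) (hlast : ∀ j, A (Fin.last n) j = B (Fin.last n) j)
    (hrow : ∀ (i : Fin n) j, A i.castSucc j = B i.castSucc j + c i * A i.succ j) :
    A.det = B.det := by
  -- Reversing rows and columns together keeps the determinant and turns the following row into the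
  -- preceding one.
  rw [← Matrix.det_submatrix_equiv_self Fin.revPerm A,
    ← Matrix.det_submatrix_equiv_self Fin.revPerm B]
  refine Matrix.det_eq_of_forall_row_eq_smul_add_pred (fun i => c i.rev) (fun j => ?_)
    (fun i j => ?_)
  · simp [hlast]
  · simp [hrow, Fin.rev_succ, Fin.rev_castSucc]

theorem det_of_last_col_eq_zero {n : ℕ} (A : Matrix (Fin (n + 1)) (Fin (n + 1)) R)
    (h : ∀ i : Fin n, A i.castSucc (Fin.last n) = 0) :
    A.det = A (Fin.last n) (Fin.last n) *
      (A.submatrix Fin.castSucc Fin.castSucc).det := by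
  rw [Matrix.det_succ_column A (Fin.last n), Fin.sum_univ_castSucc]
  simp [h, ← two_mul, Fin.succAbove_last]

/-- Multilinear expansion of a determinant whose rows are sums. -/
theorem det_of_sum_rows {n : ℕ} {κ : Type*} (A : Fin n → Finset κ) (g : Fin n → κ → R)
    (v : κ → Fin n → Fin n → R) :
    (Matrix.of fun i j => ∑ k ∈ A i, g i k * v k i j).det =
      ∑ p ∈ Fintype.piFinset A, (∏ i, g i (p i)) * (Matrix.of fun i j => v (p i) i j).det := by
  classical
  have := (Matrix.detRowAlternating (R := R) (n := Fin n)).toMultilinearMap.map_sum_finset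
    (fun i k => g i k • v k i) A
  have h2 : ∀ p : Fin n → κ,
      (Matrix.detRowAlternating (R := R) (n := Fin n)).toMultilinearMap
        (fun i => g i (p i) • v (p i) i) =
      (∏ i, g i (p i)) * (Matrix.of fun i j => v (p i) i j).det := by
    intro p
    rw [MultilinearMap.map_smul_univ]
    rfl
  simp only [h2] at this
  rw [← this]
  change Matrix.det _ = Matrix.det _
  congr 1
  ext i j
  simp [Finset.sum_apply]

/-- The factor that the entries `n + 1` contribute when passing from the inner shape `q`
to the outer shape `l`. -/
def lastEntryWeight {n : ℕ} (y : ℕ → R) (z : R) (l : Fin (n + 1) → ℕ) (q : Fin n → ℕ) : R :=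
  (∏ i : Fin n, ∏ c ∈ Finset.Ico (q i) (l i.castSucc), (z + y (n + c - i))) *
    factorialPow y z (l (Fin.last n))

/-- The shapes interlacing `l`. -/
def interlacing {n : ℕ} (l : Fin (n + 1) → ℕ) : Finset (Fin n → ℕ) :=
  Fintype.piFinset fun i : Fin n => Finset.Icc (l i.succ) (l i.castSucc)

/-- With `z` the last variable, telescoping writes row `i` as a multiple of row `i + 1`, with
coefficient independent of the column, plus a remainder divisible by `x_j - z`. Removing these
multiples clears the last column except at the bottom. The factors `x_j - z` then leave the columns
of the remaining minor, and multilinearity expands its rows into a sum over interlacing shapes. -/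
theorem alternant_succ {n : ℕ} (y : ℕ → R) (x : Fin (n + 1) → R) {l : Fin (n + 1) → ℕ}
    (hl : Antitone l) :
    alternant y x l = (∏ j : Fin n, (x j.castSucc - x (Fin.last n))) *
      ∑ q ∈ interlacing l, lastEntryWeight y (x (Fin.last n)) l q *
        alternant y (fun i : Fin n => x i.castSucc) q := by
  set z := x (Fin.last n) with hz
  let S : Fin n → Fin (n + 1) → R := fun i j =>
    ∑ k ∈ Finset.Icc (l i.succ) (l i.castSucc),
      (∏ c ∈ Finset.Ico k (l i.castSucc), (z + y (n + c - i))) *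
        factorialPow y (x j) (k + (Fin.rev i : ℕ))
  -- The matrix left after the row operations; its last row is untouched.
  let B : Matrix (Fin (n + 1)) (Fin (n + 1)) R := Matrix.of
    (Fin.snoc (α := fun _ => Fin (n + 1) → R) (fun (i : Fin n) j => (x j - z) * S i j)
      (fun j => factorialPow y (x j) (l (Fin.last n))))
  have hAB : alternant y x l = B.det := by
    refine det_eq_of_row_eq_add_mul_succ
      (fun i => ∏ c ∈ Finset.Ico (l i.succ) (l i.castSucc + 1),
        (z + y ((Fin.rev i : ℕ) + c))) (fun j => ?_) (fun i j => ?_)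
    · simp [B, shiftedPart]
    · have hi := i.2
      have h := factorialPow_telescope y (x j) z (Fin.rev i : ℕ)
        (hl (Fin.castSucc_lt_succ (i := i)).le)
      have e1 : shiftedPart l i.castSucc = l i.castSucc + ((Fin.rev i : ℕ) + 1) := by
        simp only [shiftedPart, Fin.val_rev, Fin.val_castSucc]; omega
      have e2 : shiftedPart l i.succ = l i.succ + (Fin.rev i : ℕ) := by
        simp only [shiftedPart, Fin.val_rev, Fin.val_succ]; omega
      -- The telescoping index is the index of `y` at an entry `n` (counted from `0`) in row `i`,
      -- column `c`.
      have e3 : ∀ c, (Fin.rev i : ℕ) + 1 + c = n + c - i := by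
        intro c; simp only [Fin.val_rev]; omega
      simp only [e3] at h
      simp only [Matrix.of_apply, e1, e2, B, Fin.snoc_castSucc, S]
      exact h
  rw [hAB, det_of_last_col_eq_zero _ (fun i => by simp [B, hz])]
  have hB : B.submatrix Fin.castSucc Fin.castSucc =
      Matrix.of fun i j : Fin n => (x j.castSucc - z) * S i j.castSucc := by
    ext i j; simp [B]
  have hS := det_of_sum_rows
    (fun i : Fin n => Finset.Icc (l i.succ) (l i.castSucc))
    (fun i k => ∏ c ∈ Finset.Ico k (l i.castSucc), (z + y (n + c - i)))
    (fun k i j => factorialPow y (x j.castSucc) (k + (Fin.rev i : ℕ)))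
  rw [hB, Matrix.det_mul_row (fun j : Fin n => x j.castSucc - z)
    (fun i j => S i j.castSucc)]
  change _ * (_ * (Matrix.of fun i j : Fin n => S i j.castSucc).det) = _
  rw [hS]
  simp only [B, Matrix.of_apply, Fin.snoc_last, Finset.mul_sum, interlacing, lastEntryWeight]
  refine Finset.sum_congr rfl fun q _ => ?_
  change _ * (_ * (_ * alternant y _ q)) = _
  rw [← hz]
  ring

end Alternant

/-! ### Tableaux with the largest entry removed, and the bialternant formula -/

section Tableaux

variable {n : ℕ}

/-- The tableau sum `∑_T ∏_a (x_a + y_{a + c(a) - r(a)})` evaluated in a commutative ring. -/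
noncomputable def tableauSum {R : Type*} [CommRing R] (y : ℕ → R) (x : Fin n → R)
    (lam : Parts n) : R :=
  ∑ T ∈ tableaux lam, ∏ b : Box lam, (x (T b) + y ((T b : ℕ) + (b.2 : ℕ) - (b.1 : ℕ)))

theorem mem_tableaux {lam : Parts n} {T : Box lam → Fin n} : T ∈ tableaux lam ↔ IsTableau T := by
  classical simp [tableaux]

theorem IsTableau.row_le {lam : Parts n} {T : Box lam → Fin n} (hT : IsTableau T)
    (r : ℕ) : ∀ (hr : r < n) (c : Fin (lam.1 ⟨r, hr⟩)), r ≤ T ⟨⟨r, hr⟩, c⟩ := by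
  induction r with
  | zero => intros; exact Nat.zero_le _
  | succ r ih =>
    intro hr c
    have hle : lam.1 ⟨r + 1, hr⟩ ≤ lam.1 ⟨r, by omega⟩ := lam.2 (by simp)
    have h1 := ih (by omega) (Fin.castLE hle c)
    have h2 := hT.2 ⟨⟨r, by omega⟩, Fin.castLE hle c⟩ ⟨⟨r + 1, hr⟩, c⟩ (by simp) (by simp)
    have h3 : (T ⟨⟨r, by omega⟩, Fin.castLE hle c⟩ : ℕ) < T ⟨⟨r + 1, hr⟩, c⟩ := h2
    omega

/-- The shape formed by the entries different from the largest one. -/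
def innerShape {lam : Parts (n + 1)} (T : Box lam → Fin (n + 1)) (r : Fin n) : ℕ :=
  (Finset.univ.filter fun c : Fin (lam.1 r.castSucc) => T ⟨r.castSucc, c⟩ < Fin.last n).card

/-- Rows increase weakly, so the entries below the maximum form an initial segment of each row, and
counting them locates its end. -/
theorem IsTableau.lt_last_iff {lam : Parts (n + 1)} {T : Box lam → Fin (n + 1)}
    (hT : IsTableau T) (r : Fin n) (c : Fin (lam.1 r.castSucc)) :
    T ⟨r.castSucc, c⟩ < Fin.last n ↔ (c : ℕ) < innerShape T r := by
  constructor
  · intro h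
    have : Finset.Iic c ⊆ Finset.univ.filter fun c : Fin (lam.1 r.castSucc) =>
        T ⟨r.castSucc, c⟩ < Fin.last n := by
      intro d hd
      simp only [Finset.mem_filter, Finset.mem_univ, true_and]
      have hdc : d ≤ c := Finset.mem_Iic.mp hd
      exact lt_of_le_of_lt (hT.1 ⟨r.castSucc, d⟩ ⟨r.castSucc, c⟩ rfl hdc) h
    have := Finset.card_le_card this
    rw [Fin.card_Iic] at this
    exact this
  · intro h
    by_contra hc
    have : (Finset.univ.filter fun c : Fin (lam.1 r.castSucc) =>
        T ⟨r.castSucc, c⟩ < Fin.last n) ⊆ Finset.Iio c := by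
      intro d hd
      simp only [Finset.mem_filter, Finset.mem_univ, true_and] at hd
      rw [Finset.mem_Iio]
      by_contra hcd
      exact hc (lt_of_le_of_lt (hT.1 ⟨r.castSucc, c⟩ ⟨r.castSucc, d⟩ rfl (not_lt.mp hcd)) hd)
    have := Finset.card_le_card this
    rw [Fin.card_Iio] at this
    exact absurd h (not_lt.mpr this)

theorem mem_interlacing {l : Fin (n + 1) → ℕ} {q : Fin n → ℕ} :
    q ∈ interlacing l ↔ ∀ i : Fin n, l i.succ ≤ q i ∧ q i ≤ l i.castSucc := by
  simp [interlacing]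

theorem antitone_of_mem_interlacing {l : Fin (n + 1) → ℕ} {q : Fin n → ℕ} (hl : Antitone l)
    (hq : q ∈ interlacing l) : Antitone q := by
  rw [mem_interlacing] at hq
  intro i j hij
  rcases hij.eq_or_lt with rfl | hij
  · exact le_rfl
  · exact (hq j).2.trans ((hl (Fin.succ_le_castSucc_iff.mpr hij)).trans (hq i).1)

theorem IsTableau.innerShape_mem {lam : Parts (n + 1)} {T : Box lam → Fin (n + 1)}
    (hT : IsTableau T) : innerShape T ∈ interlacing lam.1 := by
  refine mem_interlacing.mpr fun i => ⟨?_, ?_⟩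
  · by_contra h
    push Not at h
    have hle : lam.1 i.succ ≤ lam.1 i.castSucc := lam.2 (Fin.castSucc_lt_succ (i := i)).le
    -- If row `i + 1` were longer than the inner row `i`, the box just past the inner row would hold
    -- the maximum with a strictly larger entry beneath it.
    have h1 := (hT.lt_last_iff i ⟨innerShape T i, h.trans_le hle⟩).not.mpr (lt_irrefl _)
    exact h1 ((hT.2 ⟨i.castSucc, ⟨_, h.trans_le hle⟩⟩ ⟨i.succ, ⟨_, h⟩⟩ rfl
      (Fin.castSucc_lt_succ (i := i))).trans_le (Fin.le_last _))
  · exact (Finset.card_le_univ _).trans (by simp)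

/-- Extend a tableau of inner shape `mu` to shape `lam` by filling in the largest entry. -/
def extendTableau (lam : Parts (n + 1)) {mu : Parts n} (T : Box mu → Fin n) :
    Box lam → Fin (n + 1) := fun b =>
  if h : (b.1 : ℕ) < n then
    if h2 : (b.2 : ℕ) < mu.1 ⟨b.1, h⟩ then (T ⟨⟨b.1, h⟩, ⟨b.2, h2⟩⟩).castSucc else Fin.last n
  else Fin.last n

theorem extendTableau_inner {lam : Parts (n + 1)} {mu : Parts n} (T : Box mu → Fin n)
    (r : Fin n) (c : Fin (lam.1 r.castSucc)) (hc : (c : ℕ) < mu.1 r) :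
    extendTableau lam T ⟨r.castSucc, c⟩ = (T ⟨r, ⟨c, hc⟩⟩).castSucc := by
  simp [extendTableau, hc]

theorem extendTableau_outer {lam : Parts (n + 1)} {mu : Parts n} (T : Box mu → Fin n)
    (r : Fin n) (c : Fin (lam.1 r.castSucc)) (hc : mu.1 r ≤ (c : ℕ)) :
    extendTableau lam T ⟨r.castSucc, c⟩ = Fin.last n := by
  simp [extendTableau, hc]

theorem extendTableau_last {lam : Parts (n + 1)} {mu : Parts n} (T : Box mu → Fin n)
    (c : Fin (lam.1 (Fin.last n))) :
    extendTableau lam T ⟨Fin.last n, c⟩ = Fin.last n := by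
  simp [extendTableau]

theorem innerShape_extendTableau {lam : Parts (n + 1)} {mu : Parts n} (T : Box mu → Fin n)
    (hmu : mu.1 ∈ interlacing lam.1) : innerShape (extendTableau lam T) = mu.1 := by
  funext r
  have h : ∀ c : Fin (lam.1 r.castSucc),
      extendTableau lam T ⟨r.castSucc, c⟩ < Fin.last n ↔ (c : ℕ) < mu.1 r := by
    intro c
    rcases lt_or_ge (c : ℕ) (mu.1 r) with hc | hc
    · simp [extendTableau_inner T r c hc, hc, Fin.castSucc_lt_last]
    · simp [extendTableau_outer T r c hc, hc]
  simp only [innerShape, h]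
  rw [Fin.card_filter_val_lt]
  exact min_eq_right (mem_interlacing.mp hmu r).2

theorem isTableau_extendTableau {lam : Parts (n + 1)} {mu : Parts n} {T : Box mu → Fin n}
    (hmu : mu.1 ∈ interlacing lam.1) (hT : IsTableau T) : IsTableau (extendTableau lam T) := by
  rw [mem_interlacing] at hmu
  constructor
  · rintro ⟨r, c⟩ ⟨r', c'⟩ (rfl : r = r') (hc : (c : ℕ) ≤ c')
    induction r using Fin.lastCases with
    | last => simp [extendTableau_last]
    | cast r =>
      rcases lt_or_ge (c' : ℕ) (mu.1 r) with h | h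
      · rw [extendTableau_inner T r c' h, extendTableau_inner T r c (hc.trans_lt h)]
        exact Fin.castSucc_le_castSucc_iff.mpr (hT.1 _ _ rfl hc)
      · rw [extendTableau_outer T r c' h]
        exact Fin.le_last _
  · rintro ⟨r, c⟩ ⟨r', c'⟩ (hc : (c : ℕ) = c') (hr : r < r')
    have hrn : (r : ℕ) < n := by have := r'.2; have : (r : ℕ) < r' := hr; omega
    obtain ⟨r, rfl⟩ : ∃ s : Fin n, r = s.castSucc := ⟨⟨r, hrn⟩, rfl⟩
    -- By interlacing, a box with another box below it in its column belongs to the inner shape.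
    have hcr : (c : ℕ) < mu.1 r := by
      have h1 : lam.1 r' ≤ lam.1 r.succ := lam.2 (Fin.castSucc_lt_iff_succ_le.mp hr)
      have := (hmu r).1
      have := c'.2
      omega
    rw [extendTableau_inner T r c hcr]
    induction r' using Fin.lastCases with
    | last => rw [extendTableau_last]; exact Fin.castSucc_lt_last _
    | cast r' =>
      rcases lt_or_ge (c' : ℕ) (mu.1 r') with h | h
      · rw [extendTableau_inner T r' c' h]
        exact Fin.castSucc_lt_castSucc_iff.mpr (hT.2 _ _ hc hr)
      · rw [extendTableau_outer T r' c' h]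
        exact Fin.castSucc_lt_last _

theorem extendTableau_injective {lam : Parts (n + 1)} {mu : Parts n}
    (hmu : mu.1 ∈ interlacing lam.1) :
    Function.Injective (extendTableau lam : (Box mu → Fin n) → _) := by
  intro T T' h
  funext ⟨r, c⟩
  have hle := (mem_interlacing.mp hmu r).2
  have := congrFun h ⟨r.castSucc, Fin.castLE hle c⟩
  rw [extendTableau_inner T r _ c.2, extendTableau_inner T' r _ c.2] at this
  exact Fin.castSucc_injective _ this

theorem IsTableau.exists_extendTableau {lam : Parts (n + 1)} {mu : Parts n}
    {T : Box lam → Fin (n + 1)} (hT : IsTableau T) (h : innerShape T = mu.1) :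
    ∃ T' : Box mu → Fin n, IsTableau T' ∧ extendTableau lam T' = T := by
  have hmu : mu.1 ∈ interlacing lam.1 := h ▸ hT.innerShape_mem
  have hle : ∀ r, mu.1 r ≤ lam.1 r.castSucc := fun r => (mem_interlacing.mp hmu r).2
  have hlt : ∀ (r : Fin n) (c : Fin (mu.1 r)),
      T ⟨r.castSucc, Fin.castLE (hle r) c⟩ < Fin.last n := fun r c =>
    (hT.lt_last_iff r _).mpr (by rw [h]; exact c.2)
  let T' : Box mu → Fin n := fun b =>
    (T ⟨b.1.castSucc, Fin.castLE (hle b.1) b.2⟩).castPred (hlt b.1 b.2).ne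
  refine ⟨T', ⟨fun a b hab hc => ?_, fun a b hab hc => ?_⟩, ?_⟩
  · exact Fin.castPred_le_castPred_iff.mpr
      (hT.1 _ _ (congrArg Fin.castSucc hab) hc)
  · exact Fin.castPred_lt_castPred_iff.mpr
      (hT.2 _ _ hab (Fin.castSucc_lt_castSucc_iff.mpr hc))
  · funext ⟨r, c⟩
    induction r using Fin.lastCases with
    | last =>
      rw [extendTableau_last]
      refine le_antisymm ?_ (Fin.le_last _)
      -- Entries are at least their row index, so the bottom row contains only the maximum.
      exact hT.row_le n (Nat.lt_succ_self n) c
    | cast r =>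
      rcases lt_or_ge (c : ℕ) (mu.1 r) with hc | hc
      · rw [extendTableau_inner T' r c hc]
        exact Fin.castSucc_castPred _ _
      · rw [extendTableau_outer T' r c hc]
        have := (hT.lt_last_iff r c).not.mpr (by rw [h]; exact not_lt.mpr hc)
        exact le_antisymm (not_lt.mp this) (Fin.le_last _)

theorem prod_extendTableau {R : Type*} [CommRing R] (y : ℕ → R) (x : Fin (n + 1) → R)
    {lam : Parts (n + 1)} {mu : Parts n} (hmu : mu.1 ∈ interlacing lam.1) (T : Box mu → Fin n) :
    ∏ b : Box lam, (x (extendTableau lam T b) +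
        y ((extendTableau lam T b : ℕ) + (b.2 : ℕ) - (b.1 : ℕ))) =
      lastEntryWeight y (x (Fin.last n)) lam.1 mu.1 *
        ∏ b : Box mu, (x (T b).castSucc + y ((T b : ℕ) + (b.2 : ℕ) - (b.1 : ℕ))) := by
  rw [Fintype.prod_sigma, Fintype.prod_sigma, Fin.prod_univ_castSucc, lastEntryWeight]
  have h1 : ∀ r : Fin n, ∏ c : Fin (lam.1 r.castSucc),
      (x (extendTableau lam T ⟨r.castSucc, c⟩) +
        y ((extendTableau lam T ⟨r.castSucc, c⟩ : ℕ) + (c : ℕ) - (r.castSucc : ℕ))) =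
      (∏ c ∈ Finset.Ico (mu.1 r) (lam.1 r.castSucc), (x (Fin.last n) + y (n + c - r))) *
      ∏ c : Fin (mu.1 r), (x (T ⟨r, c⟩).castSucc + y ((T ⟨r, c⟩ : ℕ) + (c : ℕ) - (r : ℕ))) := by
    intro r
    have hle := (mem_interlacing.mp hmu r).2
    -- A single function on all columns, so that the product over a row splits at the end of the
    -- inner row.
    let g : ℕ → R := fun c => if h : c < mu.1 r then
      x (T ⟨r, ⟨c, h⟩⟩).castSucc + y ((T ⟨r, ⟨c, h⟩⟩ : ℕ) + c - (r : ℕ)) else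
      x (Fin.last n) + y (n + c - r)
    have hg : ∀ c : Fin (lam.1 r.castSucc), x (extendTableau lam T ⟨r.castSucc, c⟩) +
        y ((extendTableau lam T ⟨r.castSucc, c⟩ : ℕ) + (c : ℕ) - (r.castSucc : ℕ)) = g c := by
      intro c
      rcases lt_or_ge (c : ℕ) (mu.1 r) with hc | hc
      · simp [extendTableau_inner T r c hc, g, hc]
      · simp [extendTableau_outer T r c hc, g, hc]
    have hg' : ∀ c : Fin (mu.1 r),
        x (T ⟨r, c⟩).castSucc + y ((T ⟨r, c⟩ : ℕ) + (c : ℕ) - (r : ℕ)) = g c := by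
      intro c
      simp [g]
    simp only [hg, hg']
    rw [Fin.prod_univ_eq_prod_range g, Fin.prod_univ_eq_prod_range g,
      ← Finset.prod_range_mul_prod_Ico g hle, mul_comm]
    congr 1
    refine Finset.prod_congr rfl fun c hc => ?_
    simp [g, (Finset.mem_Ico.mp hc).1]
  have h2 : ∏ c : Fin (lam.1 (Fin.last n)),
      (x (extendTableau lam T ⟨Fin.last n, c⟩) +
        y ((extendTableau lam T ⟨Fin.last n, c⟩ : ℕ) + (c : ℕ) - (Fin.last n : ℕ))) =
      factorialPow y (x (Fin.last n)) (lam.1 (Fin.last n)) := by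
    simp only [extendTableau_last, Fin.val_last, Nat.add_sub_cancel_left]
    exact Fin.prod_univ_eq_prod_range (fun c => x (Fin.last n) + y c) _
  rw [h2, Finset.prod_congr rfl fun r _ => h1 r, Finset.prod_mul_distrib]
  ring

/-- Grouping tableaux by inner shape gives the recursion of `alternant_succ`: the weight of the
removed boxes is `lastEntryWeight`, and the factors `x_j - x_{n+1}` are the new part of the
Vandermonde product. -/
theorem tableauSum_mul_vandermondeProd {R : Type*} [CommRing R] (y : ℕ → R) :
    ∀ {n : ℕ} (x : Fin n → R) (lam : Parts n),
      tableauSum y x lam * vandermondeProd x = alternant y x lam.1 := by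
  intro n
  induction n with
  | zero =>
    intro x lam
    have : tableaux lam = {fun b => b.1.elim0} := by
      ext T
      rw [mem_tableaux, Finset.mem_singleton]
      exact ⟨fun _ => funext fun b => b.1.elim0,
        fun _ => ⟨fun a => a.1.elim0, fun a => a.1.elim0⟩⟩
    have : IsEmpty (Box lam) := ⟨fun b => b.1.elim0⟩
    simp [tableauSum, *, vandermondeProd, alternant]
  | succ n ih =>
    intro x lam
    classical
    rw [alternant_succ y x lam.2, vandermondeProd_succ, tableauSum,
      ← Finset.sum_fiberwise_of_maps_to (g := innerShape) (t := interlacing lam.1)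
        (fun T hT => (mem_tableaux.mp hT).innerShape_mem), Finset.sum_mul, Finset.mul_sum]
    refine Finset.sum_congr rfl fun q hq => ?_
    let mu : Parts n := ⟨q, antitone_of_mem_interlacing lam.2 hq⟩
    have hfib : ∑ T ∈ (tableaux lam).filter (fun T => innerShape T = q),
        ∏ b : Box lam, (x (T b) + y ((T b : ℕ) + (b.2 : ℕ) - (b.1 : ℕ))) =
        lastEntryWeight y (x (Fin.last n)) lam.1 q *
          tableauSum y (fun i : Fin n => x i.castSucc) mu := by
      rw [tableauSum, Finset.mul_sum]
      symm
      refine Finset.sum_bij (fun T _ => extendTableau lam T) ?_ ?_ ?_ ?_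
      · intro T hT
        exact Finset.mem_filter.mpr ⟨mem_tableaux.mpr
          (isTableau_extendTableau (mu := mu) hq (mem_tableaux.mp hT)),
          innerShape_extendTableau (mu := mu) T hq⟩
      · intro T _ T' _ h
        exact extendTableau_injective (mu := mu) hq h
      · intro T hT
        obtain ⟨hT, hq'⟩ := Finset.mem_filter.mp hT
        obtain ⟨T', hT', rfl⟩ := (mem_tableaux.mp hT).exists_extendTableau (mu := mu) hq'
        exact ⟨T', mem_tableaux.mpr hT', rfl⟩
      · intro T _
        exact (prod_extendTableau y x (mu := mu) hq T).symm
    have := ih (fun i : Fin n => x i.castSucc) mu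
    rw [hfib, ← this]
    ring

end Tableaux

/-! ### Partitions as strictly decreasing sequences, and Cauchy–Binet -/

section ShiftedParts

variable {n : ℕ}

theorem strictAnti_shiftedPart (mu : Parts n) : StrictAnti (shiftedPart mu.1) := by
  intro i j hij
  have h1 := mu.2 hij.le
  have h2 : (Fin.rev j : ℕ) < (Fin.rev i : ℕ) := Fin.rev_lt_rev.mpr hij
  simp only [shiftedPart]
  omega

theorem shiftedPart_injective :
    Function.Injective (fun mu : Parts n => shiftedPart mu.1) := by
  intro mu nu h
  ext i
  have := congrFun h i
  simp only [shiftedPart] at this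
  omega

theorem StrictAnti.rev_add_le {f : Fin n → ℕ} (hf : StrictAnti f) {i j : Fin n} (hij : i ≤ j) :
    (Fin.rev i : ℕ) + f j ≤ Fin.rev j + f i := by
  obtain ⟨k, hk⟩ : ∃ k, (j : ℕ) = i + k := ⟨j - i, by have : (i : ℕ) ≤ j := hij; omega⟩
  induction k generalizing j with
  | zero => rw [show j = i from Fin.ext (by simpa using hk)]
  | succ k ih =>
    have hj := j.2
    let j' : Fin n := ⟨i + k, by omega⟩
    have h1 := ih (j := j') (Fin.le_def.mpr (Nat.le_add_right _ _)) rfl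
    have h2 : f j < f j' := hf (Fin.lt_def.mpr (by simp only [j']; omega))
    have h3 : (Fin.rev j' : ℕ) = Fin.rev j + 1 := by simp only [Fin.val_rev, j']; omega
    omega

theorem StrictAnti.exists_shiftedPart {f : Fin n → ℕ} (hf : StrictAnti f) :
    ∃ mu : Parts n, shiftedPart mu.1 = f := by
  have h0 : ∀ i : Fin n, (Fin.rev i : ℕ) ≤ f i := by
    intro i
    have hi := i.2
    -- Compare with the last index, where `Fin.rev` is `0`.
    have := hf.rev_add_le (i := i) (j := ⟨n - 1, by omega⟩) (Fin.le_def.mpr (by simp; omega))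
    simp only [Fin.val_rev] at *
    omega
  refine ⟨⟨fun i => f i - Fin.rev i, fun i j hij => ?_⟩, funext fun i => ?_⟩
  · have := hf.rev_add_le hij
    have := h0 i
    have := h0 j
    change f j - (Fin.rev j : ℕ) ≤ f i - (Fin.rev i : ℕ)
    omega
  · exact Nat.sub_add_cancel (h0 i)

/-- The partitions whose shifted parts are all less than `N`. -/
def partsBelow (n N : ℕ) : Finset (Parts n) :=
  ((Fintype.piFinset fun _ : Fin n => Finset.range N).subtype Antitone).filter
    fun mu => ∀ i, shiftedPart mu.1 i < N

theorem mem_partsBelow {N : ℕ} {mu : Parts n} :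
    mu ∈ partsBelow n N ↔ ∀ i, shiftedPart mu.1 i < N := by
  simp only [partsBelow, Finset.mem_filter, Finset.mem_subtype, Fintype.mem_piFinset,
    Finset.mem_range, and_iff_right_iff_imp]
  exact fun h i => (Nat.le_add_right _ _).trans_lt (h i)

theorem perm_eq_one_of_strictAnti_comp {f g : Fin n → ℕ} (hf : StrictAnti f) (hg : StrictAnti g)
    {σ : Equiv.Perm (Fin n)} (h : f ∘ σ = g) : σ = 1 := by
  have hσ : StrictMono σ := by
    intro i j hij
    have := hg hij
    rw [← h] at this
    exact hf.lt_iff_gt.mp this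
  -- `Fin n` has only one order automorphism.
  have := Subsingleton.elim (hσ.orderIsoOfSurjective σ σ.surjective) (OrderIso.refl (Fin n))
  ext i
  exact congrArg (fun e : Fin n ≃o Fin n => (e i : ℕ)) this

/-- A sum over `n`-tuples of a function vanishing on non-injective tuples, by sorting. -/
theorem sum_piFinset_eq_sum_partsBelow {M : Type*} [AddCommMonoid M] (N : ℕ)
    (F : (Fin n → ℕ) → M) (hF : ∀ p, ¬ Function.Injective p → F p = 0) :
    ∑ p ∈ Fintype.piFinset (fun _ : Fin n => Finset.range N), F p =
      ∑ mu ∈ partsBelow n N, ∑ σ : Equiv.Perm (Fin n), F (shiftedPart mu.1 ∘ σ) := by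
  rw [← Finset.sum_product']
  symm
  refine Finset.sum_of_injOn (fun q => shiftedPart q.1.1 ∘ q.2) ?_ ?_ ?_ (fun _ _ => rfl)
  · rintro ⟨mu, σ⟩ - ⟨nu, τ⟩ - h
    simp only at h
    have h1 : shiftedPart mu.1 ∘ (σ * τ⁻¹ : Equiv.Perm (Fin n)) = shiftedPart nu.1 := by
      funext i
      have := congrFun h (τ⁻¹ i)
      simpa using this
    have h2 := perm_eq_one_of_strictAnti_comp (strictAnti_shiftedPart mu)
      (strictAnti_shiftedPart nu) h1
    rw [h2] at h1
    rw [mul_inv_eq_one] at h2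
    exact Prod.ext (shiftedPart_injective h1) h2
  · rintro ⟨mu, σ⟩ h
    have h := mem_partsBelow.mp (Finset.mem_product.mp h).1
    simp only [Finset.mem_coe, Fintype.mem_piFinset, Finset.mem_range]
    exact fun i => h (σ i)
  · intro p hp hp'
    refine hF p fun hinj => hp' ?_
    -- Sorting in the dual order makes the tuple decreasing; injectivity makes it strictly so.
    let σ := Tuple.sort (OrderDual.toDual ∘ p)
    have hmono : Monotone ((OrderDual.toDual ∘ p) ∘ σ) := Tuple.monotone_sort _
    have hanti : Antitone (p ∘ σ) := hmono
    have hstrict : StrictAnti (p ∘ σ) :=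
      hanti.strictAnti_of_injective (hinj.comp σ.injective)
    obtain ⟨mu, hmu⟩ := hstrict.exists_shiftedPart
    refine ⟨(mu, σ⁻¹), ?_, ?_⟩
    · simp only [Finset.coe_product, Set.mem_prod, Finset.mem_coe, Finset.mem_univ, and_true]
      refine mem_partsBelow.mpr fun i => ?_
      rw [hmu]
      exact Finset.mem_range.mp (Fintype.mem_piFinset.mp hp (σ i))
    · simp only [hmu]
      funext i
      simp

variable {R : Type*} [CommRing R]

/-- The Cauchy–Binet formula, with the minors indexed by partitions. -/
theorem det_sum_mul_eq_sum_partsBelow (N : ℕ) (A : Fin n → ℕ → R) (B : ℕ → Fin n → R) :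
    (Matrix.of fun i j => ∑ k ∈ Finset.range N, A i k * B k j).det =
      ∑ mu ∈ partsBelow n N, (Matrix.of fun i j => A i (shiftedPart mu.1 j)).det *
        (Matrix.of fun i j => B (shiftedPart mu.1 i) j).det := by
  rw [det_of_sum_rows (fun _ => Finset.range N) A (fun k _ j => B k j),
    sum_piFinset_eq_sum_partsBelow]
  · refine Finset.sum_congr rfl fun mu _ => ?_
    have h : ∀ σ : Equiv.Perm (Fin n),
        (Matrix.of fun i j => B ((shiftedPart mu.1 ∘ σ) i) j).det =
          Equiv.Perm.sign σ * (Matrix.of fun i j => B (shiftedPart mu.1 i) j).det := fun σ =>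
      Matrix.det_permute σ (Matrix.of fun i j => B (shiftedPart mu.1 i) j)
    simp only [h]
    generalize (Matrix.of fun i j => B (shiftedPart mu.1 i) j).det = b
    rw [← Matrix.det_transpose, Matrix.det_apply', Finset.sum_mul]
    refine Finset.sum_congr rfl fun σ _ => ?_
    simp only [Matrix.transpose_apply, Matrix.of_apply, Function.comp_apply]
    ring
  · intro p hp
    obtain ⟨i, j, hij, hne⟩ : ∃ i j, p i = p j ∧ i ≠ j := by
      simpa [Function.Injective] using hp
    rw [Matrix.det_zero_of_row_eq hne (by funext k; simp [hij]), mul_zero]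

/-- Two strictly decreasing sequences can agree up to a permutation only if the permutation is
trivial, so only the identity term of the determinant can survive. -/
theorem det_ite_shiftedPart (lam mu : Parts n) :
    (Matrix.of fun i j => if shiftedPart lam.1 i = shiftedPart mu.1 j then (1 : R) else 0).det =
      if lam = mu then 1 else 0 := by
  rw [Matrix.det_apply', Finset.sum_eq_single 1]
  · simp only [Equiv.Perm.sign_one, Equiv.Perm.one_apply, Matrix.of_apply, Units.val_one,
      Int.cast_one, one_mul]
    split_ifs with h
    · simp [h]
    · obtain ⟨i, hi⟩ := Function.ne_iff.mp (shiftedPart_injective.ne h)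
      exact Finset.prod_eq_zero (Finset.mem_univ i) (if_neg hi)
  · intro σ _ hσ
    by_cases h : ∀ i, shiftedPart lam.1 (σ i) = shiftedPart mu.1 i
    · exact absurd (perm_eq_one_of_strictAnti_comp (strictAnti_shiftedPart lam)
        (strictAnti_shiftedPart mu) (funext h)) hσ
    · push Not at h
      obtain ⟨i, hi⟩ := h
      rw [Finset.prod_eq_zero (Finset.mem_univ i), mul_zero]
      simp [hi]
  · simp

end ShiftedParts

/-! ### Powers versus factorial powers: the inverse matrices of `e` and `h` -/

section SymmetricPolynomials

variable {R : Type*} [CommRing R]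

theorem eInt_of_neg {r : ℤ} (hr : r < 0) (p : ℕ) (z : ℕ → R) : eInt r p z = 0 :=
  if_neg (not_le.mpr hr)

theorem hInt_of_neg {r : ℤ} (hr : r < 0) (p : ℕ) (z : ℕ → R) : hInt r p z = 0 :=
  if_neg (not_le.mpr hr)

theorem natDegree_prod_X_add_C_range_le (z : ℕ → R) (p : ℕ) :
    (∏ k ∈ Finset.range p, (Polynomial.X + Polynomial.C (z k))).natDegree ≤ p := by
  refine (Polynomial.natDegree_prod_le _ _).trans
    ((Finset.sum_le_card_nsmul _ _ 1 fun k _ => ?_).trans ?_)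
  · exact Polynomial.natDegree_add_C.trans_le Polynomial.natDegree_X_le
  · simp

theorem coeff_prod_X_add_C_range (z : ℕ → R) (p q : ℕ) :
    (∏ k ∈ Finset.range p, (Polynomial.X + Polynomial.C (z k))).coeff q =
      eInt ((p : ℤ) - q) p z := by
  rcases le_or_gt q p with h | h
  · rw [← Fin.prod_univ_eq_prod_range (fun k => Polynomial.X + Polynomial.C (z k)) p,
      Finset.prod_X_add_C_coeff _ _ (by simpa using h), eInt, if_pos (by omega),
      aeval_esymm_eq_multiset_esymm, Finset.esymm_map_val]
    congr 2
    simp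
  · rw [eInt_of_neg (by omega)]
    exact Polynomial.coeff_eq_zero_of_natDegree_lt
      ((natDegree_prod_X_add_C_range_le z p).trans_lt h)

theorem factorialPow_eq_sum {S : Type*} [CommRing S] [Algebra R S] (y : ℕ → R) (z : S)
    {p N : ℕ} (hp : p < N) :
    factorialPow (fun k => algebraMap R S (y k)) z p =
      ∑ q ∈ Finset.range N, algebraMap R S (eInt ((p : ℤ) - q) p y) * z ^ q := by
  have h : factorialPow (fun k => algebraMap R S (y k)) z p =
      Polynomial.aeval z (∏ k ∈ Finset.range p, (Polynomial.X + Polynomial.C (y k))) := by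
    simp [factorialPow, map_prod]
  have hdeg : (∏ k ∈ Finset.range p, (Polynomial.X + Polynomial.C (y k))).natDegree < N :=
    (natDegree_prod_X_add_C_range_le y p).trans_lt hp
  rw [h, Polynomial.aeval_eq_sum_range' hdeg]
  simp only [coeff_prod_X_add_C_range, Algebra.smul_def]

theorem hInt_zero_left (p : ℕ) (z : ℕ → R) : hInt 0 p z = 1 := by
  simp [hInt]

theorem hInt_zero_right {r : ℤ} (hr : r ≠ 0) (z : ℕ → R) : hInt r 0 z = 0 := by
  rcases lt_or_ge r 0 with h | h
  · exact hInt_of_neg h _ _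
  · obtain ⟨k, hk⟩ : ∃ k, r.toNat = k + 1 := ⟨r.toNat - 1, by omega⟩
    rw [hInt, if_pos h, hk]
    simp [hsymm]

theorem aeval_hsymm_eq_sum {σ : Type*} [Fintype σ] [DecidableEq σ] (k : ℕ) (f : σ → R) :
    aeval f (hsymm σ ℤ k) = ∑ s : Sym σ k, (s.1.map f).prod := by
  simp [hsymm, map_sum, map_multiset_prod, Multiset.map_map]

theorem aeval_hsymm_equiv {σ τ : Type*} [Fintype σ] [DecidableEq σ] [Fintype τ] [DecidableEq τ]
    (e : σ ≃ τ) (k : ℕ) (f : τ → R) :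
    aeval f (hsymm τ ℤ k) = aeval (f ∘ e) (hsymm σ ℤ k) := by
  rw [← rename_hsymm σ ℤ k e, aeval_rename]

/-- A multiset of size `k + 1` either contains `none`, and one copy is removed, or lies entirely in
`σ`. -/
theorem aeval_hsymm_option {σ : Type*} [Fintype σ] [DecidableEq σ] (k : ℕ)
    (f : Option σ → R) :
    aeval f (hsymm (Option σ) ℤ (k + 1)) =
      f none * aeval f (hsymm (Option σ) ℤ k) +
        aeval (fun i => f (some i)) (hsymm σ ℤ (k + 1)) := by
  rw [aeval_hsymm_eq_sum, aeval_hsymm_eq_sum, aeval_hsymm_eq_sum,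
    ← symOptionSuccEquiv.symm.sum_comp, Fintype.sum_sum_type, Finset.mul_sum]
  congr 1
  · refine Finset.sum_congr rfl fun s _ => ?_
    change (Multiset.map f (none ::ₘ s.1)).prod = _
    simp
  · refine Finset.sum_congr rfl fun s _ => ?_
    change (Multiset.map f (Multiset.map some s.1)).prod = _
    rw [Multiset.map_map]
    rfl

theorem hInt_succ {r : ℤ} (p : ℕ) (z : ℕ → R) :
    hInt r (p + 1) z = hInt r p z + z p * hInt (r - 1) (p + 1) z := by
  rcases lt_trichotomy r 0 with h | rfl | h
  · rw [hInt_of_neg h, hInt_of_neg h, hInt_of_neg (by omega)]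
    simp
  · rw [hInt_zero_left, hInt_zero_left, hInt_of_neg (by omega)]
    simp
  · obtain ⟨k, rfl⟩ : ∃ k : ℕ, r = k + 1 := ⟨(r - 1).toNat, by omega⟩
    have e : ((k : ℤ) + 1).toNat = k + 1 := by omega
    rw [hInt, hInt, hInt, if_pos (by omega), if_pos (by omega), if_pos (by omega), e,
      add_sub_cancel_right, Int.toNat_natCast,
      aeval_hsymm_equiv finSuccEquivLast.symm, aeval_hsymm_equiv finSuccEquivLast.symm,
      aeval_hsymm_option]
    simp [Function.comp_def, add_comm]

/-- Expansion of powers in factorial powers. -/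
theorem pow_eq_sum_factorialPow {S : Type*} [CommRing S] [Algebra R S] (y : ℕ → R) (z : S)
    {p N : ℕ} (hp : p < N) :
    z ^ p = ∑ q ∈ Finset.range N,
      algebraMap R S (hInt ((p : ℤ) - q) (q + 1) (fun k => -y k)) *
        factorialPow (fun k => algebraMap R S (y k)) z q := by
  induction p with
  | zero =>
    rw [Finset.sum_eq_single 0]
    · simp [hInt_zero_left, factorialPow]
    · intro q _ hq
      rw [hInt_of_neg (by omega)]
      simp
    · simp; omega
  | succ p ih =>
    obtain ⟨N, rfl⟩ : ∃ M, N = M + 1 := ⟨N - 1, by omega⟩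
    -- The recurrence of `hInt_succ` in the last variable `-y q` matches `z = (z + y q) - y q` in
    -- the product `(z | y)^q * z`.
    have h1 : ∀ q : ℕ, algebraMap R S (hInt (((p + 1 : ℕ) : ℤ) - q) (q + 1) (fun k => -y k)) =
        algebraMap R S (hInt (((p + 1 : ℕ) : ℤ) - q) q (fun k => -y k)) -
        algebraMap R S (y q) * algebraMap R S (hInt ((p : ℤ) - q) (q + 1) (fun k => -y k)) := by
      intro q
      rw [hInt_succ, show ((p + 1 : ℕ) : ℤ) - q - 1 = p - q by push_cast; ring]
      simp [sub_eq_add_neg]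
    -- Shift of `q` by one: on the left the term `q = 0` has positive degree in no variables, on the
    -- right the term `q = N` has negative degree.
    have h2 : ∑ q ∈ Finset.range (N + 1),
        algebraMap R S (hInt (((p + 1 : ℕ) : ℤ) - q) q (fun k => -y k)) *
          factorialPow (fun k => algebraMap R S (y k)) z q =
        ∑ q ∈ Finset.range (N + 1),
          algebraMap R S (hInt ((p : ℤ) - q) (q + 1) (fun k => -y k)) *
            factorialPow (fun k => algebraMap R S (y k)) z (q + 1) := by
      rw [Finset.sum_range_succ', Finset.sum_range_succ _ N,
        hInt_zero_right (by push_cast; omega), hInt_of_neg (r := (p : ℤ) - N) (by omega)]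
      simp
    simp only [h1, sub_mul, Finset.sum_sub_distrib]
    rw [h2, pow_succ, ih (by omega), Finset.sum_mul, ← Finset.sum_sub_distrib]
    refine Finset.sum_congr rfl fun q _ => ?_
    rw [factorialPow_succ]
    ring

/-- The matrix `(e_{p-q}(y_(p)))`. -/
noncomputable def eMatrix (y : ℕ → R) (N : ℕ) : Matrix (Fin N) (Fin N) R :=
  Matrix.of fun p q => eInt ((p : ℤ) - q) p y

/-- The matrix `(h_{p-q}((-y)_(q+1)))`, inverse to `eMatrix`. -/
noncomputable def hMatrix (y : ℕ → R) (N : ℕ) : Matrix (Fin N) (Fin N) R :=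
  Matrix.of fun p q => hInt ((p : ℤ) - q) (q + 1) (fun k => -y k)

/-- Expand `X ^ p` in factorial powers inside `R[X]`, then compare coefficients of `X ^ q`. -/
theorem hMatrix_mul_eMatrix (y : ℕ → R) (N : ℕ) : hMatrix y N * eMatrix y N = 1 := by
  ext p q
  have h := pow_eq_sum_factorialPow y (Polynomial.X : Polynomial R) p.2
  have h2 := congrArg (fun f => Polynomial.coeff f q) h
  simp only [Polynomial.finsetSum_coeff, Polynomial.algebraMap_eq, Polynomial.coeff_C_mul,
    factorialPow, coeff_prod_X_add_C_range, Polynomial.coeff_X_pow] at h2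
  rw [Finset.sum_range fun k => hInt ((p : ℤ) - k) (k + 1) (fun k => -y k) *
    eInt ((k : ℤ) - q) k y] at h2
  rw [Matrix.mul_apply, Matrix.one_apply]
  simp only [eMatrix, hMatrix, Matrix.of_apply]
  rw [← h2]
  simp [Fin.ext_iff, eq_comm]

theorem eMatrix_mul_hMatrix (y : ℕ → R) (N : ℕ) : eMatrix y N * hMatrix y N = 1 :=
  mul_eq_one_comm.mp (hMatrix_mul_eMatrix y N)

theorem eInt_zero_left (p : ℕ) (z : ℕ → R) : eInt 0 p z = 1 := by
  simp [eInt]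

theorem det_eMatrix (y : ℕ → R) (N : ℕ) : (eMatrix y N).det = 1 := by
  rw [Matrix.det_of_isLowerTriangular]
  · simp [eMatrix, eInt_zero_left]
  · intro i j hij
    have : i < j := hij
    exact eInt_of_neg (by omega) _ _

theorem eInt_neg (r : ℤ) (p : ℕ) (z : ℕ → R) :
    eInt r p (fun k => -z k) = (-1) ^ r.natAbs * eInt r p z := by
  rcases lt_or_ge r 0 with h | h
  · rw [eInt_of_neg h, eInt_of_neg h, mul_zero]
  · rw [eInt, eInt, if_pos h, if_pos h, aeval_esymm_eq_multiset_esymm,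
      aeval_esymm_eq_multiset_esymm]
    have := Multiset.esymm_neg (Finset.univ.val.map fun i : Fin p => z i) r.toNat
    rw [Multiset.map_map] at this
    refine this.trans ?_
    congr 2
    omega

theorem map_eInt {S : Type*} [CommRing S] (f : R →+* S) (r : ℤ) (p : ℕ) (z : ℕ → R) :
    f (eInt r p z) = eInt r p (fun k => f (z k)) := by
  unfold eInt
  split_ifs
  · change f.toIntAlgHom _ = _
    rw [← AlgHom.comp_apply, comp_aeval]
    rfl
  · exact map_zero f

end SymmetricPolynomials

/-! ### Complementary partitions and the sign of the associated permutation -/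

section Complement

variable {n m : ℕ}

theorem lt_conj_iff (lam : Parts n) (t : ℕ) (i : Fin n) : (i : ℕ) < conj lam t ↔ t < lam.1 i := by
  constructor
  · intro h
    by_contra hc
    have : (Finset.univ.filter fun k : Fin n => t < lam.1 k) ⊆ Finset.Iio i := by
      intro k hk
      simp only [Finset.mem_filter, Finset.mem_univ, true_and] at hk
      rw [Finset.mem_Iio]
      by_contra hik
      exact hc (hk.trans_le (lam.2 (not_lt.mp hik)))
    have := Finset.card_le_card this
    rw [Fin.card_Iio] at this
    exact absurd h (not_lt.mpr this)
  · intro h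
    have : Finset.Iic i ⊆ Finset.univ.filter fun k : Fin n => t < lam.1 k := by
      intro k hk
      simp only [Finset.mem_filter, Finset.mem_univ, true_and]
      exact h.trans_le (lam.2 (Finset.mem_Iic.mp hk))
    have := Finset.card_le_card this
    rw [Fin.card_Iic] at this
    exact this

theorem shiftedPart_complPart (lam : Parts n) (j : Fin m) :
    shiftedPart (complPart m lam).1 j = n - conj lam (Fin.rev j) + Fin.rev j := rfl

theorem shiftedPart_complPart_lt (lam : Parts n) (j : Fin m) :
    shiftedPart (complPart m lam).1 j < n + m := by
  rw [shiftedPart_complPart]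
  have := (Fin.rev j).2
  omega

theorem shiftedPart_lt {lam : Parts n} (h : ∀ i, lam.1 i ≤ m) (i : Fin n) :
    shiftedPart lam.1 i < n + m := by
  have h1 := h i
  have h2 := (Fin.rev i).2
  rw [shiftedPart]
  omega

/-- The shifted parts of a partition and of its complement are distinct, and their order is
determined by the boxes of the diagram. -/
theorem shiftedPart_lt_complPart (lam : Parts n) (i : Fin n) (j : Fin m)
    (h : lam.1 i ≤ Fin.rev j) : shiftedPart lam.1 i < shiftedPart (complPart m lam).1 j := by
  have h1 := (lt_conj_iff lam (Fin.rev j) i).not.mpr (not_lt.mpr h)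
  have := i.2
  rw [shiftedPart_complPart, shiftedPart, Fin.val_rev i]
  omega

theorem complPart_lt_shiftedPart (lam : Parts n) (i : Fin n) (j : Fin m)
    (h : (Fin.rev j : ℕ) < lam.1 i) :
    shiftedPart (complPart m lam).1 j < shiftedPart lam.1 i := by
  have h1 := (lt_conj_iff lam (Fin.rev j) i).mpr h
  have := i.2
  rw [shiftedPart_complPart, shiftedPart, Fin.val_rev i]
  omega

/-- The permutation of `{0, …, n + m - 1}` listing the shifted parts of `lam`, then those
of its complement. -/
noncomputable def complPerm (lam : Parts n) (h : ∀ i, lam.1 i ≤ m) :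
    Equiv.Perm (Fin (n + m)) :=
  Equiv.ofBijective
    (Fin.addCases (motive := fun _ => Fin (n + m))
      (fun i => ⟨shiftedPart lam.1 i, shiftedPart_lt h i⟩)
      (fun j => ⟨shiftedPart (complPart m lam).1 j, shiftedPart_complPart_lt lam j⟩)) <| by
    have hne : ∀ (i : Fin n) (j : Fin m),
        shiftedPart lam.1 i ≠ shiftedPart (complPart m lam).1 j := fun i j => by
      rcases lt_or_ge (Fin.rev j : ℕ) (lam.1 i) with h | h
      · exact (complPart_lt_shiftedPart lam i j h).ne'
      · exact (shiftedPart_lt_complPart lam i j h).ne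
    refine Finite.injective_iff_bijective.mp fun a b hab => ?_
    induction a using Fin.addCases with
    | left i =>
      induction b using Fin.addCases with
      | left i' =>
        simp only [Fin.addCases_left, Fin.mk.injEq] at hab
        rw [(strictAnti_shiftedPart lam).injective hab]
      | right j =>
        simp only [Fin.addCases_left, Fin.addCases_right, Fin.mk.injEq] at hab
        exact absurd hab (hne i j)
    | right j =>
      induction b using Fin.addCases with
      | left i =>
        simp only [Fin.addCases_left, Fin.addCases_right, Fin.mk.injEq] at hab
        exact absurd hab.symm (hne i j)
      | right j' =>
        simp only [Fin.addCases_right, Fin.mk.injEq] at hab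
        rw [(strictAnti_shiftedPart (complPart m lam)).injective hab]

theorem complPerm_castAdd (lam : Parts n) (h : ∀ i, lam.1 i ≤ m) (i : Fin n) :
    (complPerm lam h (Fin.castAdd m i) : ℕ) = shiftedPart lam.1 i := by
  simp [complPerm]

theorem complPerm_natAdd (lam : Parts n) (h : ∀ i, lam.1 i ≤ m) (j : Fin m) :
    (complPerm lam h (Fin.natAdd n j) : ℕ) = shiftedPart (complPart m lam).1 j := by
  simp [complPerm]

theorem sum_shiftedPart_complPart (lam : Parts n) (h : ∀ i, lam.1 i ≤ m) :
    ∑ j, shiftedPart (complPart m lam).1 j + ∑ i, lam.1 i + ∑ i : Fin n, (Fin.rev i : ℕ) =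
      ∑ k : Fin (n + m), (k : ℕ) := by
  rw [← Equiv.sum_comp (complPerm lam h), Fin.sum_univ_add]
  simp only [complPerm_castAdd, complPerm_natAdd]
  simp only [shiftedPart, Finset.sum_add_distrib]
  ring

theorem sign_eq_prod_prod_ite {N : ℕ} (σ : Equiv.Perm (Fin N)) :
    Equiv.Perm.sign σ = ∏ i, ∏ j, if i < j then (if σ i < σ j then 1 else -1) else 1 := by
  rw [Equiv.Perm.sign_eq_prod_prod_Iio, Finset.prod_comm]
  refine Finset.prod_congr rfl fun j _ => ?_
  rw [← Finset.prod_filter]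
  congr 1
  ext i
  simp

/-- Both blocks are decreasing, so every pair within a block is an inversion, independently of
`lam`. A pair across the blocks is an inversion exactly when it corresponds to a box of the diagram,
which contributes `(-1)^{|λ|}`. -/
theorem sign_complPerm (lam : Parts n) (h : ∀ i, lam.1 i ≤ m) :
    Equiv.Perm.sign (complPerm lam h) =
      (∏ i : Fin n, ∏ j : Fin n, if i < j then -1 else 1) *
        (∏ i : Fin m, ∏ j : Fin m, if i < j then -1 else 1) * (-1) ^ ∑ i, lam.1 i := by
  rw [sign_eq_prod_prod_ite, Fin.prod_univ_add]
  simp only [Fin.prod_univ_add, Finset.prod_mul_distrib]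
  have h1 : ∀ i j : Fin n, (if Fin.castAdd m i < Fin.castAdd m j then
      (if complPerm lam h (Fin.castAdd m i) < complPerm lam h (Fin.castAdd m j) then 1 else -1)
      else 1 : ℤˣ) = if i < j then -1 else 1 := by
    intro i j
    by_cases hij : i < j
    · have := strictAnti_shiftedPart lam hij
      rw [if_pos (by exact hij), if_pos hij, if_neg]
      rw [Fin.lt_def, complPerm_castAdd, complPerm_castAdd]
      omega
    · rw [if_neg hij, if_neg (by exact hij)]
  have h2 : ∀ i j : Fin m, (if Fin.natAdd n i < Fin.natAdd n j then
      (if complPerm lam h (Fin.natAdd n i) < complPerm lam h (Fin.natAdd n j) then 1 else -1)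
      else 1 : ℤˣ) = if i < j then -1 else 1 := by
    intro i j
    by_cases hij : i < j
    · have := strictAnti_shiftedPart (complPart m lam) hij
      rw [if_pos (by simpa using hij), if_pos hij, if_neg]
      rw [Fin.lt_def, complPerm_natAdd, complPerm_natAdd]
      omega
    · rw [if_neg hij, if_neg (by simpa using hij)]
  have h3 : ∀ (i : Fin n) (j : Fin m), (if Fin.castAdd m i < Fin.natAdd n j then
      (if complPerm lam h (Fin.castAdd m i) < complPerm lam h (Fin.natAdd n j) then 1 else -1)
      else 1 : ℤˣ) = if (Fin.rev j : ℕ) < lam.1 i then -1 else 1 := by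
    intro i j
    have hi := i.2
    rw [if_pos (by rw [Fin.lt_def, Fin.val_castAdd, Fin.val_natAdd]; omega)]
    simp only [Fin.lt_def, complPerm_castAdd, complPerm_natAdd]
    by_cases hij : (Fin.rev j : ℕ) < lam.1 i
    · rw [if_pos hij, if_neg (complPart_lt_shiftedPart lam i j hij).not_gt]
    · rw [if_neg hij, if_pos (shiftedPart_lt_complPart lam i j (not_lt.mp hij))]
  have h4 : ∀ (i : Fin n) (j : Fin m), (if Fin.natAdd n j < Fin.castAdd m i then
      (if complPerm lam h (Fin.natAdd n j) < complPerm lam h (Fin.castAdd m i) then 1 else -1)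
      else 1 : ℤˣ) = 1 := by
    intro i j
    have hi := i.2
    rw [if_neg (by rw [Fin.lt_def, Fin.val_castAdd, Fin.val_natAdd]; omega)]
  have h5 : ∀ i : Fin n, ∏ j : Fin m, (if (Fin.rev j : ℕ) < lam.1 i then -1 else 1 : ℤˣ) =
      (-1) ^ lam.1 i := by
    intro i
    refine (Equiv.prod_comp Fin.revPerm
      (fun j : Fin m => (if (j : ℕ) < lam.1 i then -1 else 1 : ℤˣ))).trans ?_
    rw [Finset.prod_ite, Finset.prod_const_one, mul_one, Finset.prod_const,
      Fin.card_filter_val_lt, min_eq_right (h i)]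
  simp only [h1, h2, h3, h4, h5, Finset.prod_const_one, one_mul, Finset.prod_pow_eq_pow_sum]
  rw [mul_right_comm]

end Complement

/-! ### Jacobi's identity and the comparison of `h`-minors with `e`-minors -/

section ComplementaryMinors

variable {n m : ℕ} {R : Type*} [CommRing R]

/-- Jacobi's complementary minor identity for block matrices. -/
theorem det_mul_det_toBlocks₁₁_of_mul_eq_one {ι κ : Type*} [Fintype ι] [Fintype κ]
    [DecidableEq ι] [DecidableEq κ] {M M' : Matrix (ι ⊕ κ) (ι ⊕ κ) R} (h : M * M' = 1) :
    M.det * M'.toBlocks₁₁.det = M.toBlocks₂₂.det := by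
  rw [← Matrix.fromBlocks_toBlocks M, ← Matrix.fromBlocks_toBlocks M',
    Matrix.fromBlocks_multiply, ← Matrix.fromBlocks_one, Matrix.fromBlocks_inj] at h
  -- Replacing the second block column of `M'` by that of the identity makes the product block
  -- triangular.
  have key : M * Matrix.fromBlocks M'.toBlocks₁₁ 0 M'.toBlocks₂₁ 1 =
      Matrix.fromBlocks 1 M.toBlocks₁₂ 0 M.toBlocks₂₂ := by
    conv_lhs => rw [← Matrix.fromBlocks_toBlocks M]
    rw [Matrix.fromBlocks_multiply, h.1, h.2.2.1]
    simp
  have := congrArg Matrix.det key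
  rwa [Matrix.det_mul, Matrix.det_fromBlocks_zero₁₂, Matrix.det_fromBlocks_zero₂₁,
    Matrix.det_one, Matrix.det_one, mul_one, one_mul] at this

/-- Reorder the indices of `E` and `H` by `complPerm` so that both minors become diagonal blocks,
and apply Jacobi's identity. The permutation signs and the signs from `e_r(-y) = (-1)^r e_r(y)`
cancel. -/
theorem det_hInt_eq_det_eInt_complPart (y : ℕ → R) (lam mu : Parts n)
    (hlam : ∀ i, lam.1 i ≤ m) (hmu : ∀ i, mu.1 i ≤ m) :
    (Matrix.of fun i j : Fin n => hInt ((shiftedPart lam.1 i : ℤ) - shiftedPart mu.1 j)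
        (shiftedPart mu.1 j + 1) (fun k => -y k)).det =
      (Matrix.of fun i j : Fin m => eInt ((shiftedPart (complPart m mu).1 i : ℤ) -
        shiftedPart (complPart m lam).1 j) (shiftedPart (complPart m mu).1 i)
          (fun k => -y k)).det := by
  let σ := complPerm lam hlam
  let τ := complPerm mu hmu
  let M := ((eMatrix y (n + m)).submatrix τ σ).submatrix finSumFinEquiv finSumFinEquiv
  let M' := ((hMatrix y (n + m)).submatrix σ τ).submatrix finSumFinEquiv finSumFinEquiv
  have hMM' : M * M' = 1 := by
    simp only [M, M', Matrix.submatrix_mul_equiv, eMatrix_mul_hMatrix, Matrix.submatrix_one_equiv]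
  -- `E` is unitriangular, so only the two permutation signs remain; their parts depending on `n`
  -- and `m` alone cancel.
  have hdet : M.det = (-1) ^ (∑ i, mu.1 i + ∑ i, lam.1 i) := by
    have : (eMatrix y (n + m)).submatrix τ σ =
        ((eMatrix y (n + m)).submatrix id σ).submatrix τ id := rfl
    simp only [M]
    rw [Matrix.det_submatrix_equiv_self, this, Matrix.det_permute, Matrix.det_permute',
      det_eMatrix, mul_one, ← Int.cast_mul, ← Units.val_mul]
    simp only [σ, τ]
    rw [sign_complPerm, sign_complPerm, mul_mul_mul_comm, Int.units_mul_self, one_mul, ← pow_add]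
    simp
  have h := det_mul_det_toBlocks₁₁_of_mul_eq_one hMM'
  have h11 : M'.toBlocks₁₁ = Matrix.of fun i j : Fin n =>
      hInt ((shiftedPart lam.1 i : ℤ) - shiftedPart mu.1 j) (shiftedPart mu.1 j + 1)
        (fun k => -y k) := by
    ext i j
    simp [M', Matrix.toBlocks₁₁, hMatrix, σ, τ, complPerm_castAdd]
  have h22 : M.toBlocks₂₂ = Matrix.of fun i j : Fin m =>
      eInt ((shiftedPart (complPart m mu).1 i : ℤ) -
        shiftedPart (complPart m lam).1 j) (shiftedPart (complPart m mu).1 i) y := by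
    ext i j
    simp [M, Matrix.toBlocks₂₂, eMatrix, σ, τ, complPerm_natAdd]
  -- Since `(-1)^{a-b} = (-1)^a (-1)^b`, the substitution `y ↦ -y` only rescales rows and columns.
  have hneg : (Matrix.of fun i j : Fin m => eInt ((shiftedPart (complPart m mu).1 i : ℤ) -
        shiftedPart (complPart m lam).1 j) (shiftedPart (complPart m mu).1 i)
          (fun k => -y k)) =
      Matrix.of fun i j : Fin m => (-1) ^ shiftedPart (complPart m mu).1 i *
        (Matrix.of fun i j : Fin m => (-1) ^ shiftedPart (complPart m lam).1 j *
          M.toBlocks₂₂ i j) i j := by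
    ext i j
    have hpow : ∀ a b : ℕ, (-1 : R) ^ ((a : ℤ) - b).natAbs = (-1) ^ a * (-1) ^ b := by
      intro a b
      rw [← pow_add]
      exact neg_one_pow_congr (by simp [Int.natAbs_even, parity_simps])
    simp only [h22, Matrix.of_apply, eInt_neg, hpow]
    ring
  -- The shifted parts of a partition and its complement have a fixed total, so the rescaling has
  -- the parity of `|λ| + |μ|`.
  have hsum := (sum_shiftedPart_complPart lam hlam).trans (sum_shiftedPart_complPart mu hmu).symm
  have hsign : (-1 : R) ^ (∑ i, shiftedPart (complPart m mu).1 i +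
      ∑ i, shiftedPart (complPart m lam).1 i) = (-1) ^ (∑ i, mu.1 i + ∑ i, lam.1 i) := by
    refine neg_one_pow_congr ?_
    rw [Nat.even_iff, Nat.even_iff]
    omega
  rw [hneg, Matrix.det_mul_column, Matrix.det_mul_row, ← h, h11, hdet,
    Finset.prod_pow_eq_pow_sum, Finset.prod_pow_eq_pow_sum, ← mul_assoc, ← mul_assoc,
    ← pow_add, hsign, ← mul_pow]
  simp

end ComplementaryMinors

/-! ### Expansion coefficients as minors, and linear independence -/

section Expansion

variable {n : ℕ}

theorem factorialPow_zero_left {R : Type*} [CommRing R] (z : R) (p : ℕ) :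
    factorialPow (fun _ => 0) z p = z ^ p := by
  simp [factorialPow]

theorem schurPoly_eq_tableauSum (lam : Parts n) :
    schurPoly lam = tableauSum (fun _ => 0) (fun i => (X i : ZXY n)) lam := by
  simp [schurPoly, tableauSum]

theorem factorialSchurPoly_eq_tableauSum (lam : Parts n) :
    factorialSchurPoly lam =
      tableauSum (fun k => algebraMap ZY (ZXY n) (X k)) (fun i => (X i : ZXY n)) lam := by
  simp [factorialSchurPoly, tableauSum, algebraMap_eq]

theorem vandermondeProd_X_ne_zero : vandermondeProd (fun i => (X i : ZXY n)) ≠ 0 := by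
  refine Finset.prod_ne_zero_iff.mpr fun i _ => Finset.prod_ne_zero_iff.mpr fun j _ => ?_
  split_ifs with h
  · exact sub_ne_zero.mpr ((X_injective (R := ZY)).ne h.ne)
  · exact one_ne_zero

/-- The minor of `(e_{p-q}(y_(p)))` with rows and columns given by two partitions. -/
noncomputable def eMinor (lam mu : Parts n) : ZY :=
  (Matrix.of fun i j : Fin n => eInt ((shiftedPart lam.1 i : ℤ) - shiftedPart mu.1 j)
    (shiftedPart lam.1 i) (fun k => (X k : ZY))).det

/-- The minor of `(h_{p-q}((-y)_(q+1)))` with rows and columns given by two partitions. -/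
noncomputable def hMinor (lam mu : Parts n) : ZY :=
  (Matrix.of fun i j : Fin n => hInt ((shiftedPart lam.1 i : ℤ) - shiftedPart mu.1 j)
    (shiftedPart mu.1 j + 1) (fun k => (-X k : ZY))).det

/-- Ensures that a sum over `partsBelow n N` is the full expansion: a shifted part of `mu` exceeding
all those of `lam` gives a zero column. -/
theorem eMinor_eq_zero {lam mu : Parts n} {N : ℕ} (hlam : lam ∈ partsBelow n N)
    (hmu : mu ∉ partsBelow n N) : eMinor lam mu = 0 := by
  rw [mem_partsBelow] at hlam hmu
  push Not at hmu
  obtain ⟨j, hj⟩ := hmu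
  rw [eMinor]
  refine Matrix.det_eq_zero_of_column_eq_zero j fun i => ?_
  have := hlam i
  rw [Matrix.of_apply, eInt_of_neg (by omega)]

theorem hMinor_eq_zero {lam mu : Parts n} {N : ℕ} (hlam : lam ∈ partsBelow n N)
    (hmu : mu ∉ partsBelow n N) : hMinor lam mu = 0 := by
  rw [mem_partsBelow] at hlam hmu
  push Not at hmu
  obtain ⟨j, hj⟩ := hmu
  rw [hMinor]
  refine Matrix.det_eq_zero_of_column_eq_zero j fun i => ?_
  have := hlam i
  rw [Matrix.of_apply, hInt_of_neg (by omega)]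

theorem exists_mem_partsBelow (s : Finset (Parts n)) : ∃ N, ∀ lam ∈ s, lam ∈ partsBelow n N := by
  refine ⟨∑ lam ∈ s, ∑ i, shiftedPart lam.1 i + 1, fun lam hlam => mem_partsBelow.mpr fun i => ?_⟩
  refine Nat.lt_succ_of_le ?_
  exact (Finset.single_le_sum (f := fun i => shiftedPart lam.1 i) (fun _ _ => Nat.zero_le _)
      (Finset.mem_univ i)).trans
    (Finset.single_le_sum (f := fun lam : Parts n => ∑ i, shiftedPart lam.1 i)
      (fun _ _ => Nat.zero_le _) hlam)

theorem algebraMap_det {R S : Type*} [CommRing R] [CommRing S] [Algebra R S]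
    (A : Matrix (Fin n) (Fin n) R) :
    algebraMap R S A.det = (Matrix.of fun i j => algebraMap R S (A i j)).det :=
  RingHom.map_det _ _

theorem factorialSchurPoly_eq_sum {lam : Parts n} {N : ℕ} (hlam : lam ∈ partsBelow n N) :
    factorialSchurPoly lam = ∑ mu ∈ partsBelow n N, eMinor lam mu • schurPoly mu := by
  refine mul_right_cancel₀ (vandermondeProd_X_ne_zero (n := n)) ?_
  rw [factorialSchurPoly_eq_tableauSum, tableauSum_mul_vandermondeProd, Finset.sum_mul]
  simp only [smul_mul_assoc, schurPoly_eq_tableauSum, tableauSum_mul_vandermondeProd]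
  have h := det_sum_mul_eq_sum_partsBelow N
    (fun (i : Fin n) k => algebraMap ZY (ZXY n) (eInt ((shiftedPart lam.1 i : ℤ) - k)
      (shiftedPart lam.1 i) (fun k => (X k : ZY)))) (fun k j => (X j : ZXY n) ^ k)
  -- The row sums in Cauchy–Binet fold back into factorial powers because every shifted part of
  -- `lam` is below `N`.
  simp only [← factorialPow_eq_sum _ _ (mem_partsBelow.mp hlam _)] at h
  refine h.trans (Finset.sum_congr rfl fun mu _ => ?_)
  rw [Algebra.smul_def, eMinor, algebraMap_det, alternant]
  simp only [factorialPow_zero_left, Matrix.of_apply]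

theorem schurPoly_eq_sum {lam : Parts n} {N : ℕ} (hlam : lam ∈ partsBelow n N) :
    schurPoly lam = ∑ mu ∈ partsBelow n N, hMinor lam mu • factorialSchurPoly mu := by
  refine mul_right_cancel₀ (vandermondeProd_X_ne_zero (n := n)) ?_
  rw [schurPoly_eq_tableauSum, tableauSum_mul_vandermondeProd, Finset.sum_mul]
  simp only [smul_mul_assoc, factorialSchurPoly_eq_tableauSum, tableauSum_mul_vandermondeProd]
  have h := det_sum_mul_eq_sum_partsBelow N
    (fun (i : Fin n) k => algebraMap ZY (ZXY n) (hInt ((shiftedPart lam.1 i : ℤ) - k)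
      (k + 1) (fun k => (-X k : ZY))))
    (fun k j => factorialPow (fun k => algebraMap ZY (ZXY n) (X k)) (X j : ZXY n) k)
  simp only [← pow_eq_sum_factorialPow _ _ (mem_partsBelow.mp hlam _)] at h
  rw [alternant]
  simp only [factorialPow_zero_left]
  refine h.trans (Finset.sum_congr rfl fun mu _ => ?_)
  rw [Algebra.smul_def, hMinor, algebraMap_det, alternant]
  simp only [Matrix.of_apply]

theorem sum_eMinor_mul_hMinor {lam nu : Parts n} {N : ℕ} (hlam : lam ∈ partsBelow n N)
    (hnu : nu ∈ partsBelow n N) :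
    ∑ mu ∈ partsBelow n N, eMinor lam mu * hMinor mu nu = if lam = nu then 1 else 0 := by
  rw [← det_ite_shiftedPart]
  refine (det_sum_mul_eq_sum_partsBelow N
    (fun i k => eInt ((shiftedPart lam.1 i : ℤ) - k) (shiftedPart lam.1 i) (fun k => (X k : ZY)))
    (fun k j => hInt ((k : ℤ) - shiftedPart nu.1 j) (shiftedPart nu.1 j + 1)
      (fun k => (-X k : ZY)))).symm.trans ?_
  congr 1
  ext1 i j
  have h := congrFun (congrFun (eMatrix_mul_hMatrix (fun k => (X k : ZY)) N)
    ⟨_, mem_partsBelow.mp hlam i⟩) ⟨_, mem_partsBelow.mp hnu j⟩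
  rw [Matrix.mul_apply, Matrix.one_apply] at h
  simp only [eMatrix, hMatrix, Matrix.of_apply, Fin.mk.injEq] at h
  simp only [Matrix.of_apply]
  rw [← h, Finset.sum_range]

theorem coeff_prod_pow_X {R : Type*} [CommRing R] (p q : Fin n → ℕ) :
    coeff (Finsupp.equivFunOnFinite.symm q) (∏ j, (X j : MvPolynomial (Fin n) R) ^ p j) =
      if p = q then 1 else 0 := by
  have : ∏ j, (X j : MvPolynomial (Fin n) R) ^ p j =
      monomial (Finsupp.equivFunOnFinite.symm p) 1 := by
    rw [monomial_eq, Finsupp.prod_fintype _ _ (by simp)]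
    simp
  rw [this, coeff_monomial]
  simp

/-- The alternant is a signed sum of monomials with exponents the permuted shifted parts of `lam`,
and only one permutation can give a decreasing exponent sequence. -/
theorem coeff_schurPoly_mul_vandermondeProd (lam mu : Parts n) :
    coeff (Finsupp.equivFunOnFinite.symm (shiftedPart mu.1))
      (schurPoly lam * vandermondeProd (fun i => (X i : ZXY n))) = if lam = mu then 1 else 0 := by
  rw [schurPoly_eq_tableauSum, tableauSum_mul_vandermondeProd, alternant,
    ← det_ite_shiftedPart (R := ZY), Matrix.det_apply, Matrix.det_apply, coeff_sum]
  refine Finset.sum_congr rfl fun σ _ => ?_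
  simp only [Matrix.of_apply, factorialPow_zero_left]
  rw [Units.smul_def, Units.smul_def, coeff_smul,
    coeff_prod_pow_X (fun i => shiftedPart lam.1 (σ i))]
  congr 1
  rw [Finset.prod_ite_zero]
  simp [funext_iff]

theorem linearIndependent_schurPoly : LinearIndependent ZY (schurPoly (n := n)) := by
  rw [linearIndependent_iff]
  intro a ha
  ext1 mu
  have h := congrArg (fun f => coeff (Finsupp.equivFunOnFinite.symm (shiftedPart mu.1))
    (f * vandermondeProd (fun i => (X i : ZXY n)))) ha
  simp only [Finsupp.linearCombination_apply, Finsupp.sum, Finset.sum_mul, smul_mul_assoc,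
    coeff_sum, coeff_smul, coeff_schurPoly_mul_vandermondeProd, zero_mul, coeff_zero] at h
  simpa using h

/-- A relation with coefficient vector `a` becomes, in the Schur basis, the vanishing of `a` times
the matrix of `e`-minors. The matrix of `h`-minors is a right inverse on `partsBelow n N`, so `a =
0`. -/
theorem linearIndependent_factorialSchurPoly :
    LinearIndependent ZY (factorialSchurPoly (n := n)) := by
  rw [linearIndependent_iff]
  intro a ha
  obtain ⟨N, hN⟩ := exists_mem_partsBelow a.support
  have h1 : ∑ mu ∈ partsBelow n N,
      (∑ lam ∈ a.support, a lam * eMinor lam mu) • schurPoly mu = 0 := by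
    rw [← ha, Finsupp.linearCombination_apply, Finsupp.sum]
    simp only [Finset.sum_smul]
    rw [Finset.sum_comm]
    refine Finset.sum_congr rfl fun lam hlam => ?_
    rw [factorialSchurPoly_eq_sum (hN lam hlam), Finset.smul_sum]
    simp only [mul_smul]
  have h2 := linearIndependent_iff'.mp (linearIndependent_schurPoly (n := n)) _ _ h1
  ext1 nu
  by_contra hnu
  have hnu' : nu ∈ a.support := Finsupp.mem_support_iff.mpr hnu
  refine hnu ?_
  calc a nu = ∑ lam ∈ a.support, a lam * if lam = nu then 1 else 0 := by
        simp
    _ = ∑ lam ∈ a.support, a lam * ∑ mu ∈ partsBelow n N, eMinor lam mu * hMinor mu nu :=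
        Finset.sum_congr rfl fun lam hlam => by
          rw [sum_eMinor_mul_hMinor (hN lam hlam) (hN nu hnu')]
    _ = ∑ mu ∈ partsBelow n N, (∑ lam ∈ a.support, a lam * eMinor lam mu) * hMinor mu nu := by
        simp only [Finset.mul_sum, Finset.sum_mul]
        rw [Finset.sum_comm]
        simp only [mul_assoc]
    _ = 0 := Finset.sum_eq_zero fun mu hmu => by rw [h2 mu hmu, zero_mul]

theorem expansionCoeffs_eq {ι R M : Type*} [CommRing R] [AddCommGroup M] [Module R M]
    {b : ι → M} (hb : LinearIndependent R b) {f : M} {c : ι →₀ R}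
    (h : f = Finsupp.linearCombination R b c) : expansionCoeffs b f = c := by
  have h2 : f = Finsupp.linearCombination R b (expansionCoeffs b f) :=
    Classical.epsilon_spec (p := fun c : ι →₀ R => f = Finsupp.linearCombination R b c) ⟨c, h⟩
  exact hb (h2.symm.trans h)

/-- Coefficients given on a finite set outside which they vanish are the expansion
coefficients. -/
theorem expansionCoeffs_of_eq_sum {ι R M : Type*} [CommRing R] [AddCommGroup M] [Module R M]
    {b : ι → M} (hb : LinearIndependent R b) {f : M} {s : Finset ι} {c : ι → R}
    (hc : ∀ i, i ∉ s → c i = 0) (h : f = ∑ i ∈ s, c i • b i) :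
    (∀ i, expansionCoeffs b f i = c i) ∧
      f = (expansionCoeffs (R := R) b f).sum fun i a => a • b i := by
  let c' : ι →₀ R := Finsupp.onFinset s c fun i hi => by
    by_contra his
    exact hi (hc i his)
  have h' : f = Finsupp.linearCombination R b c' := by
    rw [h, Finsupp.linearCombination_apply, Finsupp.onFinset_sum _ (by simp)]
  have key := expansionCoeffs_eq hb h'
  refine ⟨fun i => by rw [key]; rfl, ?_⟩
  rw [key, ← Finsupp.linearCombination_apply]
  exact h'

theorem cCoeff_spec (lam : Parts n) : (∀ mu, cCoeff lam mu = eMinor lam mu) ∧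
    factorialSchurPoly lam = (cCoeff lam).sum fun mu a => a • schurPoly mu := by
  obtain ⟨N, hN⟩ := exists_mem_partsBelow {lam}
  have hlam := hN lam (Finset.mem_singleton_self _)
  exact expansionCoeffs_of_eq_sum linearIndependent_schurPoly
    (fun mu hmu => eMinor_eq_zero hlam hmu) (factorialSchurPoly_eq_sum hlam)

theorem dCoeff_spec (lam : Parts n) : (∀ mu, dCoeff lam mu = hMinor lam mu) ∧
    schurPoly lam = (dCoeff lam).sum fun mu a => a • factorialSchurPoly mu := by
  obtain ⟨N, hN⟩ := exists_mem_partsBelow {lam}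
  have hlam := hN lam (Finset.mem_singleton_self _)
  exact expansionCoeffs_of_eq_sum linearIndependent_factorialSchurPoly
    (fun mu hmu => hMinor_eq_zero hlam hmu) (schurPoly_eq_sum hlam)

theorem shiftedPart_sub_shiftedPart (l q : Fin n → ℕ) (i j : Fin n) :
    (shiftedPart l i : ℤ) - shiftedPart q j = (l i : ℤ) - q j - i + j := by
  have := i.2
  have := j.2
  simp only [shiftedPart, Fin.val_rev]
  omega

theorem negY_eMinor {m : ℕ} (lam mu : Parts m) :
    negY (eMinor lam mu) =
      (Matrix.of fun i j : Fin m => eInt ((shiftedPart lam.1 i : ℤ) - shiftedPart mu.1 j)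
        (shiftedPart lam.1 i) (fun k => (-X k : ZY))).det := by
  rw [eMinor, AlgHom.map_det]
  congr 1
  ext1 i j
  rw [AlgHom.mapMatrix_apply, Matrix.map_apply, Matrix.of_apply, Matrix.of_apply]
  refine (map_eInt (negY : ZY →+* ZY) _ _ _).trans ?_
  simp [negY]

end Expansion

theorem propositionp (n : ℕ) :
    -- the coefficients `c` and `d` are well defined by the change of basis formulas
    (LinearIndependent ZY (schurPoly (n := n)) ∧
      LinearIndependent ZY (factorialSchurPoly (n := n)) ∧
      (∀ lam : Parts n, factorialSchurPoly lam =
        (cCoeff lam).sum fun mu a => a • schurPoly mu) ∧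
      (∀ lam : Parts n, schurPoly lam =
        (dCoeff lam).sum fun mu a => a • factorialSchurPoly mu)) ∧
    -- (i)
    (∀ lam mu : Parts n, cCoeff lam mu =
      (Matrix.of fun i j : Fin n =>
        eInt ((lam.1 i : ℤ) - mu.1 j - i + j) (lam.1 i + n - (i + 1))
          (fun k => (MvPolynomial.X k : ZY))).det) ∧
    -- (ii)
    (∀ lam mu : Parts n, dCoeff lam mu =
      (Matrix.of fun i j : Fin n =>
        hInt ((lam.1 i : ℤ) - mu.1 j - i + j) (mu.1 j + n + 1 - (j + 1))
          (fun k => (-MvPolynomial.X k : ZY))).det) ∧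
    -- (iii)
    (∀ (lam mu : Parts n) (m : ℕ), (∀ i, lam.1 i ≤ m) → (∀ i, mu.1 i ≤ m) →
      dCoeff lam mu = negY (cCoeff (complPart m mu) (complPart m lam))) := by
  refine ⟨⟨linearIndependent_schurPoly, linearIndependent_factorialSchurPoly,
    fun lam => (cCoeff_spec lam).2, fun lam => (dCoeff_spec lam).2⟩,
    fun lam mu => ?_, fun lam mu => ?_, fun lam mu m hlam hmu => ?_⟩
  · rw [(cCoeff_spec lam).1, eMinor]
    congr 1
    ext1 i j
    have hi := i.2
    rw [Matrix.of_apply, Matrix.of_apply, shiftedPart_sub_shiftedPart,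
      show shiftedPart lam.1 i = lam.1 i + n - (i + 1) by
        rw [shiftedPart, Fin.val_rev]; omega]
  · rw [(dCoeff_spec lam).1, hMinor]
    congr 1
    ext1 i j
    have hj := j.2
    rw [Matrix.of_apply, Matrix.of_apply, shiftedPart_sub_shiftedPart,
      show shiftedPart mu.1 j + 1 = mu.1 j + n + 1 - (j + 1) by
        rw [shiftedPart, Fin.val_rev]; omega]
  · rw [(dCoeff_spec lam).1, (cCoeff_spec _).1, negY_eMinor]
    exact det_hInt_eq_det_eInt_complPart _ lam mu hlam hmu
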